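/- Let $q$ be a prime power and $N\ge 0$ an integer. Let $\mathrm{PG}(N,q)$ be the $N$-dimensional projective space over the field $\mathbb F_q$ with $q$ elements: its points are the one-dimensional linear subspaces of $\mathbb F_q^{N+1}$, and a subspace of projective dimension $d$ is the set of points contained in some $(d+1)$-dimensional linear subspace of $\mathbb F_q^{N+1}$. (Lines have dimension $1$, hyperplanes dimension $N-1$, and the empty subspace dimension $-1$.) A set $B$ of points of $\mathrm{PG}(N,q)$ is a cutting blocking set if, for every hyperplane $\Lambda$, the set $B\cap\Lambda$ spans $\Lambda$. Put $$m=\begin{cases}\left\lceil \dfrac{2}{1+\frac{1}{(q+1)^2\ln q}}\,N\right\rceil & \text{if } q>2,\\[3ex] \left\lceil 1.95\,N\right\rceil & \text{if } q=2.\end{cases}$$ Then there is a cutting blocking set in $\mathrm{PG}(N,q)$ which is the union of the point sets of at most $m$ lines and which has at most $m(q+1)$ points. -/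

import Mathlib

open scoped LinearAlgebra.Projectivization

/-- The projective dimension of a subspace `Λ` of the projective space `ℙ F V`, one less than the
dimension of the corresponding linear subspace of `V`. The empty subspace has dimension `-1`, points
have dimension `0`, lines have dimension `1`. -/
noncomputable def projDim {F V : Type*} [Field F] [AddCommGroup V] [Module F V]
    (Λ : Projectivization.Subspace F V) : ℤ :=
  (Module.finrank F (Projectivization.Subspace.submodule Λ) : ℤ) - 1

/-- A line of `ℙ F V` is a subspace of projective dimension one. -/
def IsProjLine {F V : Type*} [Field F] [AddCommGroup V] [Module F V]
    (ℓ : Projectivization.Subspace F V) : Prop :=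
  projDim ℓ = 1

/-- A cutting `t`-blocking set of a projective space `ℙ F V` of finite dimension
`N = projDim ⊤ = dim V - 1`: a point set meeting each `(N - t)`-dimensional subspace `Λ` in a set of
points which spans the whole of `Λ`. -/
def IsCuttingTBlockingSet {F V : Type*} [Field F] [AddCommGroup V] [Module F V]
    (t : ℕ) (B : Set (ℙ F V)) : Prop :=
  ∀ Λ : Projectivization.Subspace F V,
    projDim Λ = projDim (⊤ : Projectivization.Subspace F V) - (t : ℤ) →
      Projectivization.Subspace.span (B ∩ (Λ : Set (ℙ F V))) = Λ

/-- A cutting blocking set is a cutting `1`-blocking set: it meets every hyperplane in a set of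
points spanning that hyperplane. -/
def IsCuttingBlockingSet {F V : Type*} [Field F] [AddCommGroup V] [Module F V]
    (B : Set (ℙ F V)) : Prop :=
  IsCuttingTBlockingSet 1 B

/-- The number of lines in the bound: `⌈2 / (1 + 1 / (ln q * (q + 1) ^ 2)) * N⌉` if `q > 2` and
`⌈1.95 * N⌉` if `q = 2`. -/
noncomputable def lineBound (N q : ℕ) : ℕ :=
  if q = 2 then ⌈(1.95 : ℝ) * (N : ℝ)⌉₊
  else ⌈2 / (1 + 1 / (Real.log (q : ℝ) * ((q : ℝ) + 1) ^ 2)) * (N : ℝ)⌉₊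

open Module

/-! The proof is a first-moment argument. A union of subspaces fails to be cutting only if some
hyperplane `ker f` meets every one of them inside another hyperplane `ker g`, with `f`, `g`
independent. Let `dim V = k + 2` and draw `m` pairs of vectors uniformly. A pair is bad for `(f, g)`
only if both vectors lie in `ker (g - c • f)` for one scalar `c`; of the `q + 1` hyperplanes through
`ker f ⊓ ker g`, `ker f` itself is lost. Hence at most `q ^ (2k+3) - (q-1) q ^ (2k)` of the `q ^
(2k+4)` pairs are bad (`ncard_spanKerPairs_add_le`).

Badness depends only on the flag `⟨f⟩ ⊂ ⟨f, g⟩`, which comes from `q (q-1)^2` pairs `(f, g)`. The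
value of `lineBound` makes the expected number of bad flags less than 1 (`count_lt_of_lineBound`),
so some choice avoids them all (`exists_forall_notMem_spanKerPairs`). -/

/-- The pairs of vectors whose linear span meets the kernel of `f` inside the kernel of `g`. -/
def spanKerPairs {F V : Type*} [Field F] [AddCommGroup V] [Module F V] (f g : Dual F V) :
    Set (V × V) :=
  {p | ∀ x ∈ Submodule.span F {p.1, p.2}, f x = 0 → g x = 0}

/-! ### Linear algebra and projective dimension -/

theorem exists_submodule_finrank_eq_of_le {F V : Type*} [Field F] [AddCommGroup V] [Module F V]
    [FiniteDimensional F V] (p : Submodule F V) {d : ℕ} (hp : finrank F p ≤ d)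
    (hd : d ≤ finrank F V) : ∃ W : Submodule F V, p ≤ W ∧ finrank F W = d := by
  obtain ⟨r, hr⟩ := p.exists_isCompl
  have hsum := Submodule.finrank_add_eq_of_isCompl hr
  obtain ⟨s, hs⟩ := exists_linearIndependent_of_le_finrank (R := F) (M := r)
    (n := d - finrank F p) (by omega)
  set t : Submodule F V := (Submodule.span F (Set.range s)).map r.subtype with ht
  have htr : t ≤ r := Submodule.map_subtype_le _ _
  have hdisj : p ⊓ t = ⊥ := (hr.disjoint.mono_right htr).eq_bot
  have hft : finrank F t = d - finrank F p := by
    rw [ht, Submodule.finrank_map_subtype_eq, finrank_span_eq_card hs,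
      Fintype.card_fin]
  refine ⟨p ⊔ t, le_sup_left, ?_⟩
  have := Submodule.finrank_sup_add_finrank_inf_eq p t
  rw [hdisj, finrank_bot] at this
  omega

theorem ncard_projectivization_of_finrank_eq_two {F V : Type*} [Field F] [Finite F]
    [AddCommGroup V] [Module F V] (W : Submodule F V) (hW : finrank F W = 2) :
    (W.projectivization : Set (ℙ F V)).ncard = Nat.card F + 1 := by
  have h : (W.projectivization : Set (ℙ F V)) =
      Set.range (Projectivization.map W.subtype W.injective_subtype) := by
    ext x
    induction x using Projectivization.ind with | h v hv =>
    rw [SetLike.mem_coe, Submodule.mk_mem_projectivization_iff]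
    constructor
    · intro hvW
      exact ⟨Projectivization.mk F (⟨v, hvW⟩ : W) (by simpa [Subtype.ext_iff] using hv), rfl⟩
    · rintro ⟨y, hy⟩
      induction y using Projectivization.ind with | h w hw =>
      rw [Projectivization.map_mk, Projectivization.mk_eq_mk_iff'] at hy
      obtain ⟨a, ha⟩ := hy
      by_cases h0 : a = 0
      · subst h0
        exact absurd (by simpa using ha.symm) (show w ≠ 0 from hw)
      · have : v = a⁻¹ • (w : V) := by
          rw [← Submodule.subtype_apply, ← ha, smul_smul, inv_mul_cancel₀ h0, one_smul]
        rw [this]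
        exact W.smul_mem _ w.2
  rw [h, ← Set.image_univ, Set.ncard_image_of_injective _ (Projectivization.map_injective _ _),
    Set.ncard_univ, Projectivization.card_of_finrank_two F W hW]

theorem projDim_top {F V : Type*} [Field F] [AddCommGroup V] [Module F V] :
    projDim (⊤ : Projectivization.Subspace F V) = finrank F V - 1 := by
  have htop : Projectivization.Subspace.submodule (⊤ : Projectivization.Subspace F V) = ⊤ :=
    map_top _
  rw [projDim, htop, finrank_top]

/-! ### Criterion for a union to be cutting -/

/-- If no hyperplane `ker f` meets all of the subspaces `W i` inside another hyperplane `ker g`,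
then the union of the `W i` is a cutting blocking set. -/
theorem isCuttingBlockingSet_iUnion {F V ι : Type*} [Field F] [AddCommGroup V] [Module F V]
    [FiniteDimensional F V] [Nontrivial V] (W : ι → Submodule F V)
    (hW : ∀ f g : Dual F V, LinearIndependent F ![f, g] → ∃ i, ∃ x ∈ W i, f x = 0 ∧ g x ≠ 0) :
    IsCuttingBlockingSet (⋃ i, ((W i).projectivization : Set (ℙ F V))) := by
  intro Λ hΛ
  set B := ⋃ i, ((W i).projectivization : Set (ℙ F V)) with hB
  have hpos : 0 < finrank F V := finrank_pos
  have hdim : finrank F (Projectivization.Subspace.submodule Λ) + 1 = finrank F V := by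
    rw [projDim_top, projDim] at hΛ
    push_cast at hΛ
    omega
  obtain ⟨f, hf0, hf⟩ := Submodule.exists_le_ker_of_lt_top
    (Projectivization.Subspace.submodule Λ) (lt_top_iff_ne_top.2 fun h => by
      rw [h, finrank_top] at hdim; omega)
  have hker : Projectivization.Subspace.submodule Λ = LinearMap.ker f := by
    refine Submodule.eq_of_le_of_finrank_eq hf ?_
    have := Module.Dual.finrank_ker_add_one_of_ne_zero hf0
    omega
  have hle : Projectivization.Subspace.span (B ∩ (Λ : Set (ℙ F V))) ≤ Λ :=
    Projectivization.Subspace.span_le_subspace_iff.2 Set.inter_subset_right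
  refine le_antisymm hle ?_
  by_contra hnot
  rw [← Projectivization.Subspace.submodule.le_iff_le, SetLike.not_le_iff_exists] at hnot
  obtain ⟨x, hxΛ, hxS⟩ := hnot
  -- `g` vanishes on the span but not at `x`, while `f x = 0`; so `f`, `g` are independent.
  obtain ⟨g, hgx, hg⟩ := Submodule.exists_le_ker_of_notMem hxS
  have hfx : f x = 0 := by rw [hker] at hxΛ; exact hxΛ
  have hli : LinearIndependent F ![f, g] := by
    rw [LinearIndependent.pair_iff]
    intro a b hab
    have hb : b = 0 := by
      have := LinearMap.congr_fun hab x
      simpa [hfx, hgx] using this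
    subst hb
    simpa [hf0] using hab
  obtain ⟨i, w, hwi, hfw, hgw⟩ := hW f g hli
  have hw0 : w ≠ 0 := by rintro rfl; simp at hgw
  refine hgw (hg ?_)
  rw [Projectivization.Subspace.mem_submodule_iff _ hw0]
  refine Projectivization.Subspace.subset_span _ ⟨Set.mem_iUnion.2 ⟨i, hwi⟩, ?_⟩
  rw [SetLike.mem_coe, ← Projectivization.Subspace.mem_submodule_iff _ hw0, hker]
  exact hfw

/-! ### Counting bad pairs of vectors -/

theorem spanKerPairs_subset {F V : Type*} [Field F] [AddCommGroup V] [Module F V]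
    (f g : Dual F V) :
    spanKerPairs f g ⊆
      ((LinearMap.ker f ⊓ LinearMap.ker g : Submodule F V) : Set V) ×ˢ
          ((LinearMap.ker f ⊓ LinearMap.ker g : Submodule F V) : Set V) ∪
        ⋃ c : F, ((LinearMap.ker (g - c • f) : Set V) ×ˢ (LinearMap.ker (g - c • f) : Set V)) \
          (((LinearMap.ker f ⊓ LinearMap.ker g : Submodule F V) : Set V) ×ˢ
            ((LinearMap.ker f ⊓ LinearMap.ker g : Submodule F V) : Set V)) := by
  rintro ⟨u, v⟩ hp
  have hu : u ∈ Submodule.span F {u, v} := Submodule.subset_span (by simp)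
  have hv : v ∈ Submodule.span F {u, v} := Submodule.subset_span (by simp)
  have hdet : f u * g v = f v * g u := by
    -- This vector of the span is killed by `f`, hence by `g`: the values of `f` and of `g` on `u`,
    -- `v` are proportional.
    have := hp (f u • v - f v • u)
      (Submodule.sub_mem _ (Submodule.smul_mem _ _ hv) (Submodule.smul_mem _ _ hu))
      (by simp [mul_comm])
    simpa [sub_eq_zero] using this
  rw [← Set.iUnion_sdiff, Set.union_sdiff_self]
  by_cases hfu : f u = 0
  · have hgu := hp u hu hfu
    by_cases hfv : f v = 0
    · exact Or.inl ⟨⟨hfu, hgu⟩, ⟨hfv, hp v hv hfv⟩⟩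
    · refine Or.inr (Set.mem_iUnion.2 ⟨g v / f v, ?_, ?_⟩) <;>
        simp [hfu, hgu, hfv]
  · refine Or.inr (Set.mem_iUnion.2 ⟨g u / f u, ?_, ?_⟩)
    · simp [hfu]
    · simp only [SetLike.mem_coe, LinearMap.mem_ker, LinearMap.sub_apply, LinearMap.smul_apply,
        smul_eq_mul]
      field_simp
      linear_combination hdet

theorem ncard_spanKerPairs_add_le {F V : Type*} [Field F] [Finite F] [AddCommGroup V] [Module F V]
    {k : ℕ} (hV : finrank F V = k + 2) {f g : Dual F V} (hfg : LinearIndependent F ![f, g]) :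
    (spanKerPairs f g).ncard + (Nat.card F - 1) * Nat.card F ^ (2 * k) ≤
      Nat.card F ^ (2 * k + 3) := by
  have : FiniteDimensional F V := .of_finrank_pos (by omega)
  have : Finite V := Module.finite_of_finite F
  have := Fintype.ofFinite F
  have hq : 1 < Nat.card F := Finite.one_lt_card
  set q := Nat.card F with hqdef
  set K : Submodule F V := LinearMap.ker f ⊓ LinearMap.ker g
  set A : F → Submodule F V := fun c => LinearMap.ker (g - c • f) with hA
  rw [LinearIndependent.pair_iff] at hfg
  have hAcard (c : F) : (A c : Set V).ncard = q ^ (k + 1) := by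
    have h0 : g - c • f ≠ 0 := by
      intro h
      have := (hfg (-c) 1 (by rw [← h]; module)).2
      exact one_ne_zero this
    have := Module.Dual.finrank_ker_add_one_of_ne_zero h0
    rw [← Nat.card_coe_set_eq, SetLike.coe_sort_coe, Module.natCard_eq_pow_finrank (K := F)]
    exact congr_arg _ (show finrank F (LinearMap.ker (g - c • f)) = k + 1 by omega)
  -- A lower bound suffices: with `Q = q ^ (2k+2)` and `κ = |K|²`, the estimate `κ + q (Q - κ)`
  -- decreases in `κ`.
  have hKcard : q ^ k ≤ (K : Set V).ncard := by
    have hf0 : f ≠ 0 := by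
      rintro rfl
      simpa using hfg 1 0
    have hg0 : g ≠ 0 := by
      rintro rfl
      simpa using hfg 0 1
    have h1 := Module.Dual.finrank_ker_add_one_of_ne_zero hf0
    have h2 := Module.Dual.finrank_ker_add_one_of_ne_zero hg0
    have h3 := Submodule.finrank_sup_add_finrank_inf_eq (LinearMap.ker f) (LinearMap.ker g)
    have h4 := Submodule.finrank_le (LinearMap.ker f ⊔ LinearMap.ker g)
    rw [← Nat.card_coe_set_eq, SetLike.coe_sort_coe, Module.natCard_eq_pow_finrank (K := F)]
    exact Nat.pow_le_pow_right (by omega)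
      (show k ≤ finrank F (LinearMap.ker f ⊓ LinearMap.ker g : Submodule F V) by omega)
  have hKA (c : F) : K ≤ A c := by
    rintro x ⟨hx1, hx2⟩
    simp only [SetLike.mem_coe, LinearMap.mem_ker] at hx1 hx2
    simp [hA, hx1, hx2]
  have hdiff (c : F) : (((A c : Set V) ×ˢ (A c : Set V)) \ ((K : Set V) ×ˢ (K : Set V))).ncard +
      (K : Set V).ncard * (K : Set V).ncard = q ^ (k + 1) * q ^ (k + 1) := by
    rw [← hAcard c, ← Set.ncard_prod, ← Set.ncard_prod]
    exact Set.ncard_sdiff_add_ncard_of_subset (Set.prod_mono (hKA c) (hKA c))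
  have hU : (⋃ c : F, ((A c : Set V) ×ˢ (A c : Set V)) \ ((K : Set V) ×ˢ (K : Set V))).ncard ≤
      q * (q ^ (k + 1) * q ^ (k + 1) - (K : Set V).ncard * (K : Set V).ncard) := by
    refine (Set.ncard_iUnion_le_of_fintype _).trans ?_
    rw [Finset.sum_congr rfl fun c _ => Nat.eq_sub_of_add_eq (hdiff c)]
    simp [hqdef, Nat.card_eq_fintype_card]
  have hbd := (Set.ncard_le_ncard (spanKerPairs_subset f g)).trans (Set.ncard_union_le _ _)
  rw [Set.ncard_prod] at hbd
  have h0 := hdiff 0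
  have hKle : (K : Set V).ncard * (K : Set V).ncard ≤ q ^ (k + 1) * q ^ (k + 1) := by omega
  have hKK : q ^ k * q ^ k ≤ (K : Set V).ncard * (K : Set V).ncard := Nat.mul_le_mul hKcard hKcard
  have h1 := hbd.trans (Nat.add_le_add_left hU _)
  generalize (K : Set V).ncard * (K : Set V).ncard = κ at *
  clear_value q
  obtain ⟨s, rfl⟩ : ∃ s, q = s + 1 := ⟨q - 1, by omega⟩
  obtain ⟨d, hd⟩ := Nat.exists_eq_add_of_le hKle
  rw [hd, Nat.add_sub_cancel_left] at h1
  have e1 : (s + 1) ^ (2 * k + 3) = (s + 1) * (κ + d) := by rw [← hd]; ring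
  have e2 : (s + 1) ^ (2 * k) = (s + 1) ^ k * (s + 1) ^ k := by ring
  rw [e1, e2, Nat.add_sub_cancel]
  have := Nat.mul_le_mul_left s hKK
  linarith

/-! ### First moment over flags of functionals -/

/-- Replacing `(f, g)` by `(a f, b g + c f)` does not change the condition on pairs of vectors. -/
theorem spanKerPairs_subset_smul_add {F V : Type*} [Field F] [AddCommGroup V] [Module F V]
    (f g : Dual F V) (a b : Fˣ) (c : F) :
    spanKerPairs f g ⊆ spanKerPairs (a.1 • f) (b.1 • g + c • f) := by
  intro p hp x hx hfx
  have hfx' : f x = 0 := by simpa using hfx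
  simp [hfx', hp x hx hfx']

theorem linearIndependent_pair_smul_add {F V : Type*} [Field F] [AddCommGroup V] [Module F V]
    {f g : V} (h : LinearIndependent F ![f, g]) (a b : Fˣ) (c : F) :
    LinearIndependent F ![a.1 • f, b.1 • g + c • f] := by
  rw [LinearIndependent.pair_iff] at h ⊢
  intro s t hst
  obtain ⟨h1, h2⟩ := h (s * a + t * c) (t * b) (by rw [← hst]; module)
  have ht : t = 0 := by simpa using h2
  subst ht
  simpa using h1

theorem injective_pair_smul_add {F V : Type*} [Field F] [AddCommGroup V] [Module F V]
    {f g : V} (h : LinearIndependent F ![f, g]) :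
    Function.Injective fun x : Fˣ × Fˣ × F => ![x.1.1 • f, x.2.1.1 • g + x.2.2 • f] := by
  rintro ⟨a, b, c⟩ ⟨a', b', c'⟩ hx
  rw [LinearIndependent.pair_iff] at h
  have h0 : a.1 • f = a'.1 • f := congr_fun hx 0
  have h1 : b.1 • g + c • f = b'.1 • g + c' • f := congr_fun hx 1
  have ha := (h (a.1 - a'.1) 0 (by rw [sub_smul, h0]; simp)).1
  have hbc := h (c - c') (b.1 - b'.1) (by
    rw [← sub_eq_zero] at h1; rw [← h1]; module)
  simp only [Prod.mk.injEq, Units.ext_iff]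
  exact ⟨sub_eq_zero.1 ha, sub_eq_zero.1 hbc.2, sub_eq_zero.1 hbc.1⟩

/-- The first moment argument: a count of the configurations excluded by pairs of functionals,
each class of pairs counted `q (q - 1) ^ 2` times. -/
theorem exists_forall_notMem_spanKerPairs {F V : Type*} [Field F] [Finite F] [AddCommGroup V]
    [Module F V] {k m b : ℕ} (hV : finrank F V = k + 2)
    (hb : ∀ f g : Dual F V, LinearIndependent F ![f, g] → (spanKerPairs f g).ncard ≤ b)
    (hlt : (Nat.card F ^ (k + 2) - 1) * (Nat.card F ^ (k + 2) - Nat.card F) * b ^ m <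
      Nat.card F * (Nat.card F - 1) ^ 2 * (Nat.card F ^ (2 * k + 4)) ^ m) :
    ∃ t : Fin m → V × V, ∀ f g : Dual F V, LinearIndependent F ![f, g] →
      ∃ i, t i ∉ spanKerPairs f g := by
  classical
  have : FiniteDimensional F V := .of_finrank_pos (by omega)
  have : Finite V := Module.finite_of_finite F
  have : Finite (Dual F V) := Module.finite_of_finite F
  have := Fintype.ofFinite F
  have := Fintype.ofFinite V
  have := Fintype.ofFinite (Dual F V)
  by_contra! hcon
  let P := {s : Fin 2 → Dual F V // LinearIndependent F s}
  have hP : Fintype.card P =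
      (Nat.card F ^ (k + 2) - 1) * (Nat.card F ^ (k + 2) - Nat.card F) := by
    have h := card_linearIndependent (K := F) (V := Dual F V) (k := 2)
      (by rw [Subspace.dual_finrank_eq]; omega)
    rw [Subspace.dual_finrank_eq, hV, ← Nat.card_eq_fintype_card (α := F)] at h
    rw [← Nat.card_eq_fintype_card]
    simpa [Fin.prod_univ_two] using h
  have hVV : Fintype.card (Fin m → V × V) = (Nat.card F ^ (2 * k + 4)) ^ m := by
    rw [Fintype.card_fun, Fintype.card_prod, ← Nat.card_eq_fintype_card (α := V),
      Module.natCard_eq_pow_finrank (K := F), hV, Fintype.card_fin]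
    ring
  have key := Finset.card_mul_le_card_mul (s := (Finset.univ : Finset (Fin m → V × V)))
    (t := (Finset.univ : Finset P))
    (fun t s => ∀ i, t i ∈ spanKerPairs (s.1 0) (s.1 1))
    (m := Nat.card F * (Nat.card F - 1) ^ 2) (n := b ^ m) ?_ ?_
  · rw [Finset.card_univ, Finset.card_univ, hP, hVV] at key
    linarith
  · intro t _
    obtain ⟨f, g, hfg, hbad⟩ := hcon t
    have hcard : Fintype.card (Fˣ × Fˣ × F) = Nat.card F * (Nat.card F - 1) ^ 2 := by
      rw [Fintype.card_prod, Fintype.card_prod, Fintype.card_units, Nat.card_eq_fintype_card]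
      ring
    rw [← hcard, ← Finset.card_univ]
    refine Finset.card_le_card_of_injOn
      (fun x => (⟨_, linearIndependent_pair_smul_add hfg x.1 x.2.1 x.2.2⟩ : P)) ?_ ?_
    · intro x _
      simp only [Finset.coe_bipartiteAbove, Finset.mem_univ, true_and, Set.mem_ofPred_eq]
      exact fun i => spanKerPairs_subset_smul_add f g _ _ _ (hbad i)
    · intro x _ y _ hxy
      exact injective_pair_smul_add hfg (congr_arg Subtype.val hxy)
  · intro s _
    have hs : LinearIndependent F ![s.1 0, s.1 1] := by
      convert s.2 using 1
      ext i
      fin_cases i <;> rfl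
    -- For fixed functionals the bad tuples form an `m`-fold product, whence the bound `b ^ m`.
    have : Finset.bipartiteBelow (fun (t : Fin m → V × V) (s : P) =>
        ∀ i, t i ∈ spanKerPairs (s.1 0) (s.1 1)) Finset.univ s =
        Fintype.piFinset fun _ : Fin m => (spanKerPairs (s.1 0) (s.1 1)).toFinset := by
      ext t
      simp [Finset.bipartiteBelow]
    rw [this, Fintype.card_piFinset, Finset.prod_const, Finset.card_univ, Fintype.card_fin,
      ← Set.ncard_eq_toFinset_card']
    exact Nat.pow_le_pow_left (hb _ _ hs) m

/-! ### Numerical estimates -/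

/-- Take logarithms and use `log (1 - x) ≤ -x` with `x = (q-1)/q^3`. The `(q+1)^2` of the bound
enters through `(q-1)(q+1)^2 ≥ q^3`. -/
theorem pow_mul_pow_le_of_lineBound {q N : ℕ} (hq : 3 ≤ q) :
    q ^ (2 * N) * (q ^ 3 - (q - 1)) ^ lineBound N q ≤ (q ^ 4) ^ lineBound N q := by
  set m := lineBound N q with hm
  have hq3 : (3 : ℝ) ≤ q := by exact_mod_cast hq
  have hlog : 0 < Real.log q := Real.log_pos (by linarith)
  have hpos : 0 < (q : ℝ) ^ 3 - (q - 1) := by nlinarith [sq_nonneg (q : ℝ)]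
  have hcast : ((q ^ 3 - (q - 1) : ℕ) : ℝ) = (q : ℝ) ^ 3 - (q - 1) := by
    rw [Nat.cast_sub, Nat.cast_sub] <;> push_cast
    · rfl
    · omega
    · exact (Nat.sub_le _ _).trans (Nat.le_self_pow (by norm_num) q)
  have hmN : 2 * (N : ℝ) * Real.log q ≤ m * (Real.log q + 1 / ((q : ℝ) + 1) ^ 2) := by
    have h1 : 2 / (1 + 1 / (Real.log (q : ℝ) * ((q : ℝ) + 1) ^ 2)) * (N : ℝ) ≤ m := by
      rw [hm, lineBound, if_neg (by omega)]
      exact Nat.le_ceil _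
    have h2 : 0 < Real.log q + 1 / ((q : ℝ) + 1) ^ 2 := by positivity
    have h3 : 2 / (1 + 1 / (Real.log (q : ℝ) * ((q : ℝ) + 1) ^ 2)) * (N : ℝ) =
        2 * N * Real.log q / (Real.log q + 1 / ((q : ℝ) + 1) ^ 2) := by
      field_simp
    rw [h3, div_le_iff₀ h2] at h1
    exact h1
  have hlogle : Real.log ((q : ℝ) ^ 3 - (q - 1)) ≤ 3 * Real.log q - 1 / ((q : ℝ) + 1) ^ 2 := by
    have h1 : (q : ℝ) ^ 3 - (q - 1) = (q : ℝ) ^ 3 * (1 - (q - 1) / (q : ℝ) ^ 3) := by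
      field_simp
    have h2 : 0 < 1 - ((q : ℝ) - 1) / (q : ℝ) ^ 3 := by
      rw [h1] at hpos
      exact pos_of_mul_pos_right hpos (by positivity)
    have h3 : 1 / ((q : ℝ) + 1) ^ 2 ≤ ((q : ℝ) - 1) / (q : ℝ) ^ 3 := by
      rw [div_le_div_iff₀ (by positivity) (by positivity)]
      nlinarith
    rw [h1, Real.log_mul (by positivity) h2.ne', Real.log_pow]
    have := Real.log_le_sub_one_of_pos h2
    push_cast
    linarith
  have hreal : (q : ℝ) ^ (2 * N) * ((q : ℝ) ^ 3 - (q - 1)) ^ m ≤ ((q : ℝ) ^ 4) ^ m := by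
    rw [← Real.log_le_log_iff (by positivity) (by positivity),
      Real.log_mul (by positivity) (by positivity), Real.log_pow, Real.log_pow, Real.log_pow,
      Real.log_pow]
    have := mul_le_mul_of_nonneg_left hlogle (Nat.cast_nonneg (α := ℝ) m)
    push_cast
    linarith
  rw [← hcast] at hreal
  exact_mod_cast hreal

/-- Since `1.95 = 39/20`, twentieth powers make the exponents integral. The gain `16^39 / (4^20 *
7^39)` per unit of `N` outweighs `2^20` from `N = 4` on. -/
theorem two_mul_four_pow_mul_seven_pow_lt {N m : ℕ} (hN : 4 ≤ N) (hm : 39 * N ≤ 20 * m) :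
    2 * 4 ^ N * 7 ^ m < 16 ^ m := by
  refine lt_of_pow_lt_pow_left₀ 20 (by positivity) ?_
  obtain ⟨j, rfl⟩ := Nat.exists_eq_add_of_le hN
  obtain ⟨r, hr⟩ := Nat.exists_eq_add_of_le hm
  have e1 : (2 * 4 ^ (4 + j) * 7 ^ m) ^ 20 =
      2 ^ 20 * (4 ^ 20 * 7 ^ 39) ^ 4 * (4 ^ 20 * 7 ^ 39) ^ j * 7 ^ r := by
    rw [mul_pow, ← pow_mul 7 m, mul_comm m, hr]
    rw [pow_add 7, pow_mul 7, pow_add 4, mul_pow 2, mul_pow (4 ^ 4), ← pow_mul 4, ← pow_mul 4,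
      mul_comm j, pow_mul 4 20 j, pow_add (7 ^ 39), mul_pow (4 ^ 20) (7 ^ 39) 4, mul_pow _ _ j,
      ← pow_mul 4 20 4]
    generalize 7 ^ 39 = x
    generalize 4 ^ 20 = y
    generalize 2 ^ 20 = z
    ring
  have e2 : (16 ^ m) ^ 20 = (16 ^ 39) ^ 4 * (16 ^ 39) ^ j * 16 ^ r := by
    rw [← pow_mul 16 m, mul_comm m, hr]
    simp only [pow_add, pow_mul]
  rw [e1, e2]
  have h1 : 2 ^ 20 * (4 ^ 20 * 7 ^ 39) ^ 4 < (16 ^ 39) ^ 4 := by norm_num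
  have h2 : (4 ^ 20 * 7 ^ 39) ^ j ≤ (16 ^ 39) ^ j := Nat.pow_le_pow_left (by norm_num) j
  have h3 : 7 ^ r ≤ 16 ^ r := Nat.pow_le_pow_left (by norm_num) r
  exact Nat.mul_lt_mul_of_lt_of_le (Nat.mul_lt_mul_of_lt_of_le h1 h2 (by positivity)) h3
    (by positivity)

theorem count_lt_of_lineBound_two (k : ℕ) :
    (2 ^ (k + 2) - 1) * (2 ^ (k + 2) - 2) * 7 ^ lineBound (k + 1) 2 <
      2 * 16 ^ lineBound (k + 1) 2 := by
  -- For `N = k + 1 ≤ 3` the ceiling equals `2N` and the count is checked directly.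
  obtain hk | hk := lt_or_ge k 3
  · have h : lineBound (k + 1) 2 = 2 * (k + 1) := by
      rw [lineBound, if_pos rfl, Nat.ceil_eq_iff (by omega)]
      interval_cases k <;> norm_num
    rw [h]
    interval_cases k <;> norm_num
  · have hm : 39 * (k + 1) ≤ 20 * lineBound (k + 1) 2 := by
      have h : (1.95 : ℝ) * ((k + 1 : ℕ) : ℝ) ≤ lineBound (k + 1) 2 := by
        rw [lineBound, if_pos rfl]
        exact Nat.le_ceil _
      have : (39 : ℝ) * ((k + 1 : ℕ) : ℝ) ≤ 20 * lineBound (k + 1) 2 := by linarith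
      exact_mod_cast this
    have h := two_mul_four_pow_mul_seven_pow_lt (by omega) hm
    calc (2 ^ (k + 2) - 1) * (2 ^ (k + 2) - 2) * 7 ^ lineBound (k + 1) 2
        ≤ 2 ^ (k + 2) * 2 ^ (k + 2) * 7 ^ lineBound (k + 1) 2 :=
          Nat.mul_le_mul_right _ (Nat.mul_le_mul (Nat.sub_le _ _) (Nat.sub_le _ _))
      _ = 2 * (2 * 4 ^ (k + 1) * 7 ^ lineBound (k + 1) 2) := by
          rw [show 4 = 2 ^ 2 by rfl, ← pow_mul]
          ring
      _ < _ := by omega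

theorem count_lt_of_lineBound {q : ℕ} (hq : 2 ≤ q) (k : ℕ) :
    (q ^ (k + 2) - 1) * (q ^ (k + 2) - q) *
        (q ^ (2 * k) * (q ^ 3 - (q - 1))) ^ lineBound (k + 1) q <
      q * (q - 1) ^ 2 * (q ^ (2 * k + 4)) ^ lineBound (k + 1) q := by
  set m := lineBound (k + 1) q with hm
  have hq0 : 0 < q := by omega
  suffices h : (q ^ (k + 2) - 1) * (q ^ (k + 2) - q) * (q ^ 3 - (q - 1)) ^ m <
      q * (q - 1) ^ 2 * (q ^ 4) ^ m by
    have := Nat.mul_lt_mul_of_pos_left h (show 0 < (q ^ (2 * k)) ^ m by positivity)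
    rw [pow_add q (2 * k) 4, mul_pow _ _ m, mul_pow (q ^ (2 * k)) (q ^ 4) m]
    linarith
  obtain rfl | hq3 := eq_or_lt_of_le hq
  · simpa using count_lt_of_lineBound_two k
  · have h := pow_mul_pow_le_of_lineBound (N := k + 1) hq3
    have hpos : 0 < q ^ 3 - (q - 1) := by
      have := Nat.le_self_pow (n := 3) (by norm_num) q
      omega
    -- This absorbs the surplus factor `q^2`; it fails for `q = 2`, which is why that case is
    -- separate.
    have hqq : q ≤ (q - 1) ^ 2 := by
      obtain ⟨s, rfl⟩ := Nat.exists_eq_add_of_le hq3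
      rw [show 2 + 1 + s - 1 = s + 2 by omega]
      nlinarith
    have hlt : (q ^ (k + 2) - 1) * (q ^ (k + 2) - q) < q ^ (k + 2) * q ^ (k + 2) :=
      Nat.mul_lt_mul_of_lt_of_le (Nat.sub_lt (by positivity) one_pos) (Nat.sub_le _ _)
        (by positivity)
    calc _ < q ^ (k + 2) * q ^ (k + 2) * (q ^ 3 - (q - 1)) ^ m :=
          Nat.mul_lt_mul_of_pos_right hlt (by positivity)
      _ = q * q * (q ^ (2 * (k + 1)) * (q ^ 3 - (q - 1)) ^ m) := by ring
      _ ≤ q * (q - 1) ^ 2 * (q ^ 4) ^ m := Nat.mul_le_mul (Nat.mul_le_mul_left _ hqq) h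

/-! ### Assembly -/

theorem isCuttingBlockingSet_empty_of_finrank_eq_one {F V : Type*} [Field F] [AddCommGroup V]
    [Module F V] (hV : finrank F V = 1) : IsCuttingBlockingSet (∅ : Set (ℙ F V)) := by
  intro Λ hΛ
  have : FiniteDimensional F V := .of_finrank_pos (by omega)
  rw [projDim_top, hV, projDim] at hΛ
  have h0 : finrank F (Projectivization.Subspace.submodule Λ) = 0 := by
    push_cast at hΛ
    omega
  rw [Submodule.finrank_eq_zero, map_eq_bot_iff] at h0
  rw [Set.empty_inter, Projectivization.Subspace.span_empty, h0]

theorem mainTheorem2 (N q : ℕ) (F : Type*) [Field F] [Finite F] (hq : Nat.card F = q)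
    (V : Type*) [AddCommGroup V] [Module F V] (hV : Module.finrank F V = N + 1) :
    ∃ B : Set (ℙ F V),
      IsCuttingBlockingSet B ∧
      B.ncard ≤ lineBound N q * (q + 1) ∧
      ∃ L : Finset (Projectivization.Subspace F V),
        L.card ≤ lineBound N q ∧
        (∀ ℓ ∈ L, IsProjLine ℓ) ∧
        B = ⋃ ℓ ∈ L, (ℓ : Set (ℙ F V)) := by
  classical
  -- For `N = 0` the only hyperplane is empty and no lines are needed.
  obtain _ | k := N
  · exact ⟨∅, isCuttingBlockingSet_empty_of_finrank_eq_one hV, by simp, ∅, by simp, by simp,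
      by simp⟩
  have : FiniteDimensional F V := .of_finrank_pos (by omega)
  have : Nontrivial V := Module.nontrivial_of_finrank_pos (R := F) (by omega)
  subst hq
  obtain ⟨t, ht⟩ := exists_forall_notMem_spanKerPairs (m := lineBound (k + 1) (Nat.card F)) hV
    (fun f g hfg => by
      have h := ncard_spanKerPairs_add_le hV hfg
      rw [pow_add, mul_comm (Nat.card F - 1)] at h
      rw [Nat.mul_sub]
      exact Nat.le_sub_of_add_le h)
    (count_lt_of_lineBound Finite.one_lt_card k)
  -- A drawn pair may be dependent; enlarging its span to a line keeps the witness `x`.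
  have hext (i) : ∃ W : Submodule F V,
      Submodule.span F {(t i).1, (t i).2} ≤ W ∧ finrank F W = 2 := by
    refine exists_submodule_finrank_eq_of_le _ ?_ (by omega)
    have h := finrank_span_finset_le_card (R := F) ({(t i).1, (t i).2} : Finset V)
    rw [Finset.coe_pair] at h
    exact h.trans Finset.card_le_two
  choose W hW hW2 using hext
  refine ⟨⋃ i, ((W i).projectivization : Set (ℙ F V)), ?_, ?_,
    Finset.univ.image fun i => (W i).projectivization, ?_, ?_, ?_⟩
  · refine isCuttingBlockingSet_iUnion W fun f g hfg => ?_
    obtain ⟨i, hi⟩ := ht f g hfg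
    simp only [spanKerPairs, Set.mem_ofPred_eq, not_forall] at hi
    obtain ⟨x, hx, hfx, hgx⟩ := hi
    exact ⟨i, x, hW i hx, hfx, hgx⟩
  · refine (Set.ncard_iUnion_le_of_fintype _).trans ?_
    simp [ncard_projectivization_of_finrank_eq_two _ (hW2 _)]
  · simpa using Finset.card_image_le (s := Finset.univ) (f := fun i => (W i).projectivization)
  · simp only [Finset.mem_image, Finset.mem_univ, true_and, forall_exists_index,
      forall_apply_eq_imp_iff]
    intro i
    have h : Projectivization.Subspace.submodule (W i).projectivization = W i :=
      OrderIso.apply_symm_apply _ _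
    rw [IsProjLine, projDim, h, hW2]
    norm_num
  · simp
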